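/- Let $\varepsilon=\{\varepsilon(t),\,t\in\mathbb R\}$ be a real stochastic process on a probability space, and let $d_0>0$. Assume: (N1) $\varepsilon$ is square integrable, mean-square continuous, has almost surely continuous paths, and $E\varepsilon(t)=0$ for all $t\in\mathbb R$. (N2) With $B(t,s)=E\varepsilon(t)\varepsilon(s)$: (i) $\varepsilon$ is jointly strictly sub-Gaussian, i.e. for all $n$, $t_1,\dots,t_n\in\mathbb R$ and $\Delta\in\mathbb R^n$, $E\exp\{\sum_i\Delta_i\varepsilon(t_i)\}\le\exp\{\tfrac12\sum_{i,j}B(t_i,t_j)\Delta_i\Delta_j\}$; (ii) for every $T>0$ and $\Delta\in L_2([0,T])$, $\int_0^T\!\int_0^T B(t,s)\Delta(t)\Delta(s)\,dt\,ds\le d_0\int_0^T\Delta^2(t)\,dt$. Let $\Theta\subset\mathbb R^q$ be open, bounded and convex with closure $\Theta^c$, and let $a(t,\tau)$ be a continuous function on $\mathbb R_+\times\Theta^c$. For $\theta\in\Theta$ one observes $X(t)=a(t,\theta)+\varepsilon(t)$, $t\in[0,T]$; a least squares estimator $\theta_T$ is any random vector with values in $\Theta^c$ such that $Q_T(\theta_T)=\inf_{\tau\in\Theta^c}Q_T(\tau)$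 almost surely, where $Q_T(\tau)=\int_0^T[X(t)-a(t,\tau)]^2dt$. Let $T_0\ge0$, let $s_T=\operatorname{diag}(s_{1T},\dots,s_{qT})$ be diagonal matrices, not depending on $\theta$ and invertible for $T>T_0$, and let $0<c_0<c_1<\infty$. Put $\Phi_T(u,v)=\int_0^T\bigl(a(t,\theta+s_T^{-1}u)-a(t,\theta+s_T^{-1}v)\bigr)^2dt$ and consider the condition (R3) $c_0\|u-v\|^2\le\Phi_T(u,v)\le c_1\|u-v\|^2$ for all $T>T_0$ and $u,v\in s_T(\Theta^c-\theta)$. Then there is $R_0$ such that for every $\beta>0$ there exist constants $B>0$ and $b>0$ with $$b\ge\frac{c_0}{8d_0(1+q)}-\beta$$ such that, for every $\theta\in\Theta$ satisfying (R3), every $T>T_0$, every least squares estimator $\theta_T$ and every $R>R_0$, $$P\{\|s_T(\theta_T-\theta)\|\ge R\}\le B\exp\{-bR^2\}.$$ -/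

import Mathlib

open MeasureTheory Set Filter Topology

noncomputable section

/-- Action of the diagonal matrix `diag (s₁, …, s_q)` on a vector of Euclidean space `ℝ^q`. -/
def diagMul {q : ℕ} (s : Fin q → ℝ) (u : EuclideanSpace ℝ (Fin q)) :
    EuclideanSpace ℝ (Fin q) :=
  WithLp.toLp 2 (fun i => s i * u i)

/-- `B(t, s) = E ε(t) ε(s)`, the covariance function of a centred process. -/
def covFun {Ω : Type*} [MeasurableSpace Ω] (P : Measure Ω) (ε : ℝ → Ω → ℝ) (t s : ℝ) : ℝ :=
  ∫ ω, ε t ω * ε s ω ∂P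

/-- A strictly sub-Gaussian random vector: `E exp ⟨ξ, Δ⟩ ≤ exp (⟨B Δ, Δ⟩ / 2)` for every
`Δ ∈ ℝⁿ`, where `B(i, j) = E ξ_i ξ_j`.  Finiteness of the left-hand side is the
integrability clause. -/
def IsStrictlySubGaussian {Ω : Type*} [MeasurableSpace Ω] (P : Measure Ω) {n : ℕ}
    (ξ : Fin n → Ω → ℝ) : Prop :=
  ∀ Δ : Fin n → ℝ,
    Integrable (fun ω => Real.exp (∑ i, ξ i ω * Δ i)) P ∧
    ∫ ω, Real.exp (∑ i, ξ i ω * Δ i) ∂P ≤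
      Real.exp (1 / 2 * ∑ i, ∑ j, (∫ ω, ξ i ω * ξ j ω ∂P) * Δ i * Δ j)

/-- A jointly strictly sub-Gaussian process: all finite-dimensional vectors are strictly
sub-Gaussian. -/
def IsJointlyStrictlySubGaussian {Ω : Type*} [MeasurableSpace Ω] (P : Measure Ω)
    (ε : ℝ → Ω → ℝ) : Prop :=
  ∀ (n : ℕ) (t : Fin n → ℝ), IsStrictlySubGaussian P (fun i => ε (t i))

/-- A centred second-order process on `ℝ` which is mean-square continuous and has almost
surely continuous paths. -/
structure IsContinuousCentredNoise {Ω : Type*} [MeasurableSpace Ω] (P : Measure Ω)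
    (ε : ℝ → Ω → ℝ) : Prop where
  measurable : ∀ t, Measurable (ε t)
  memLp_two : ∀ t, MemLp (ε t) 2 P
  mean_square_continuous :
    ∀ t₀, Tendsto (fun t => ∫ ω, (ε t ω - ε t₀ ω) ^ 2 ∂P) (𝓝 t₀) (𝓝 0)
  ae_continuous : ∀ᵐ ω ∂P, Continuous fun t => ε t ω
  mean_zero : ∀ t, ∫ ω, ε t ω ∂P = 0

/-- A jointly strictly sub-Gaussian process whose covariance operators on `L₂([0, T])`, `T > 0`,
are bounded by `d₀`. -/
structure IsSubGaussianNoise {Ω : Type*} [MeasurableSpace Ω] (P : Measure Ω)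
    (ε : ℝ → Ω → ℝ) (d₀ : ℝ) : Prop where
  jointly_sub_gaussian : IsJointlyStrictlySubGaussian P ε
  cov_bound : ∀ T : ℝ, 0 < T → ∀ Δ : ℝ → ℝ, MemLp Δ 2 (volume.restrict (Icc 0 T)) →
    ∫ t in (0 : ℝ)..T, ∫ s in (0 : ℝ)..T, covFun P ε t s * Δ t * Δ s
      ≤ d₀ * ∫ t in (0 : ℝ)..T, Δ t ^ 2

/-- The least squares functional `Q_T(τ) = ∫₀ᵀ (X(t) - a(t, τ))² dt` of the observed path `X`. -/
def lsFunctional {q : ℕ} (a : ℝ → EuclideanSpace ℝ (Fin q) → ℝ) (X : ℝ → ℝ) (T : ℝ)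
    (τ : EuclideanSpace ℝ (Fin q)) : ℝ :=
  ∫ t in (0 : ℝ)..T, (X t - a t τ) ^ 2

/-- `θT` is a least squares estimator of `θ`, obtained from the observations
`X(t) = a(t, θ) + ε(t)`, `t ∈ [0, T]`: a random vector with values in the closure of `Θ` that
minimizes the least squares functional over this closure. -/
structure IsLSE {Ω : Type*} [MeasurableSpace Ω] (P : Measure Ω) (ε : ℝ → Ω → ℝ) {q : ℕ}
    (a : ℝ → EuclideanSpace ℝ (Fin q) → ℝ) (Θ : Set (EuclideanSpace ℝ (Fin q)))
    (θ : EuclideanSpace ℝ (Fin q)) (T : ℝ) (θT : Ω → EuclideanSpace ℝ (Fin q)) : Prop where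
  measurable : Measurable θT
  mem_closure : ∀ᵐ ω ∂P, θT ω ∈ closure Θ
  minimizes : ∀ᵐ ω ∂P,
    lsFunctional a (fun t => a t θ + ε t ω) T (θT ω) =
      ⨅ τ : closure Θ, lsFunctional a (fun t => a t θ + ε t ω) T τ

/-- `U_T(θ) = s_T (Θᶜ - θ)`, where `Θᶜ` is the closure of `Θ`; here `s` is the diagonal of `s_T`. -/
def normalizedSet {q : ℕ} (Θ : Set (EuclideanSpace ℝ (Fin q)))
    (θ : EuclideanSpace ℝ (Fin q)) (s : Fin q → ℝ) : Set (EuclideanSpace ℝ (Fin q)) :=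
  (fun τ => diagMul s (τ - θ)) '' closure Θ

/-- `Δ(t, u) = a(t, θ + s_T⁻¹ u) - a(t, θ)`. -/
def regIncrement {q : ℕ} (a : ℝ → EuclideanSpace ℝ (Fin q) → ℝ)
    (θ : EuclideanSpace ℝ (Fin q)) (s : Fin q → ℝ) (t : ℝ)
    (u : EuclideanSpace ℝ (Fin q)) : ℝ :=
  a t (θ + diagMul (fun i => (s i)⁻¹) u) - a t θ

/-- `Φ_T(u, v) = ∫₀ᵀ (Δ(t, u) - Δ(t, v))² dt`. -/
def regDist {q : ℕ} (a : ℝ → EuclideanSpace ℝ (Fin q) → ℝ)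
    (θ : EuclideanSpace ℝ (Fin q)) (s : Fin q → ℝ) (T : ℝ)
    (u v : EuclideanSpace ℝ (Fin q)) : ℝ :=
  ∫ t in (0 : ℝ)..T, (regIncrement a θ s t u - regIncrement a θ s t v) ^ 2

/-- The two-sided quadratic condition
`c₀ ‖u - v‖² ≤ Φ_T(u, v) ≤ c₁ ‖u - v‖²` for all `T > T₀` and `u, v ∈ U_T(θ)`. -/
def QuadraticCondition {q : ℕ} (a : ℝ → EuclideanSpace ℝ (Fin q) → ℝ)
    (Θ : Set (EuclideanSpace ℝ (Fin q))) (θ : EuclideanSpace ℝ (Fin q))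
    (s : ℝ → Fin q → ℝ) (c₀ c₁ T₀ : ℝ) : Prop :=
  ∀ T : ℝ, T₀ < T →
    ∀ u ∈ normalizedSet Θ θ (s T), ∀ v ∈ normalizedSet Θ θ (s T),
      c₀ * ‖u - v‖ ^ 2 ≤ regDist a θ (s T) T u v ∧
      regDist a θ (s T) T u v ≤ c₁ * ‖u - v‖ ^ 2

end

/-! Write u = s_T(θ_T − θ), Φ(u) = Φ_T(u, 0) and η(u) = ∫₀ᵀ ε(t)Δ(t,u) dt. Since Q_T(θ_T) ≤ Q_T(θ),
almost surely Φ(u)/2 ≤ η(u) (`half_regDist_le_of_lsFunctional_eq`). It remains to bound the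
probability that η exceeds half of its drift somewhere in ‖u‖ ≥ R.

Passing from Riemann sums to integrals by Fatou, ∫₀ᵀ εf is sub-Gaussian with variance proxy d₀∫₀ᵀ f²
(`lintegral_exp_integral_noise_le`). At a single u, Chernoff then gives exp(−Φ(u)/(8d₀)) ≤
exp(−c₀‖u‖²/(8d₀)). For q ≥ 1 the required rate c₀/(8d₀(1+q)) is at most half of this, and the slack
pays for uniformity in u.

Cut space into unit cubes and fix a point v of U in each cube that matters. Either η(v) ≥ 3Φ(v)/8,
or η oscillates over the cube by at least c₀‖v‖²/16. Increments of η have proxy d₀c₁‖u − v‖², so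
dyadic chaining (`exists_measure_cube_oscillation_le`) makes the oscillation no likelier than the
pointwise event, up to a constant, once ‖v‖ is large. The remaining slack leaves a Gaussian weight
that is summable over the integer lattice (`exists_measure_half_drift_le`). All constants depend
only on q, c₀, c₁, d₀. -/

noncomputable section

/-! ### Riemann sums of continuous functions -/

/-- Left Riemann sum over the uniform partition of `[0, T]` into `n + 1` pieces. -/
def riemannSum (T : ℝ) (g : ℝ → ℝ) (n : ℕ) : ℝ :=
  ∑ i : Fin (n + 1), T / (n + 1) * g (T * i / (n + 1))

lemma gridPoint_mem_Icc {T : ℝ} (hT : 0 < T) (n : ℕ) (i : Fin (n + 1)) :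
    T * i / (n + 1) ∈ Icc 0 T := by
  have hi : ((i : ℕ) : ℝ) ≤ n + 1 := by exact_mod_cast i.2.le
  refine ⟨by positivity, ?_⟩
  rw [div_le_iff₀ (by positivity)]
  gcongr

lemma riemannSum_mono_abs {T : ℝ} (hT : 0 < T) {g h : ℝ → ℝ} {w : ℝ}
    (hw : ∀ t ∈ Icc 0 T, |g t - h t| ≤ w) (n : ℕ) :
    |riemannSum T g n - riemannSum T h n| ≤ T * w := by
  unfold riemannSum
  rw [← Finset.sum_sub_distrib]
  refine (Finset.abs_sum_le_sum_abs _ _).trans ?_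
  have : ∀ i ∈ (Finset.univ : Finset (Fin (n + 1))),
      |T / (n + 1) * g (T * i / (n + 1)) - T / (n + 1) * h (T * i / (n + 1))|
        ≤ T / (n + 1) * w := by
    intro i _
    rw [← mul_sub, abs_mul, abs_of_pos (by positivity)]
    gcongr
    exact hw _ (gridPoint_mem_Icc hT n i)
  refine (Finset.sum_le_sum this).trans (le_of_eq ?_)
  simp
  field_simp

lemma abs_riemannSum_sub_integral_le {T : ℝ} (hT : 0 < T) {g : ℝ → ℝ} (hg : Continuous g)
    {w : ℝ} {n : ℕ}
    (hw : ∀ x ∈ Icc 0 T, ∀ y ∈ Icc 0 T, |x - y| ≤ T / (n + 1) → |g x - g y| ≤ w) :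
    |riemannSum T g n - ∫ t in (0 : ℝ)..T, g t| ≤ T * w := by
  set p : ℕ → ℝ := fun i => T * i / (n + 1) with hp
  have hstep : ∀ i, p (i + 1) - p i = T / (n + 1) := by
    intro i
    simp only [hp]
    push_cast
    ring
  have hmono : ∀ i, p i ≤ p (i + 1) := fun i => by
    have := hstep i
    have : 0 < T / (n + 1) := by positivity
    linarith
  have hp0 : p 0 = 0 := by simp [hp]
  have hpn : p (n + 1) = T := by
    simp only [hp]
    push_cast
    field_simp
  have hsum : ∑ i ∈ Finset.range (n + 1), ∫ t in p i..p (i + 1), g t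
      = ∫ t in (0 : ℝ)..T, g t := by
    rw [intervalIntegral.sum_integral_adjacent_intervals
      (fun k _ => hg.intervalIntegrable _ _), hp0, hpn]
  have hR : riemannSum T g n
      = ∑ i ∈ Finset.range (n + 1), ∫ _ in p i..p (i + 1), g (p i) := by
    rw [riemannSum, Finset.sum_range]
    refine Finset.sum_congr rfl fun i _ => ?_
    rw [intervalIntegral.integral_const, hstep, smul_eq_mul]
  have hmem : ∀ i < n + 1, p i ∈ Icc 0 T := fun i hi =>
    gridPoint_mem_Icc hT n ⟨i, hi⟩
  have hmem' : ∀ i < n + 1, p (i + 1) ≤ T := by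
    intro i hi
    have hi' : (i : ℝ) + 1 ≤ n + 1 := by exact_mod_cast hi
    simp only [hp]
    push_cast
    rw [div_le_iff₀ (by positivity)]
    gcongr
  rw [hR, ← hsum, ← Finset.sum_sub_distrib]
  refine (Finset.abs_sum_le_sum_abs _ _).trans ?_
  have key : ∀ i ∈ Finset.range (n + 1),
      |(∫ _ in p i..p (i + 1), g (p i)) - ∫ t in p i..p (i + 1), g t| ≤ w * (T / (n + 1)) := by
    intro i hi
    have hi' := Finset.mem_range.1 hi
    rw [← intervalIntegral.integral_sub (by simp) (hg.intervalIntegrable _ _)]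
    have := intervalIntegral.norm_integral_le_of_norm_le_const
      (a := p i) (b := p (i + 1)) (C := w) (f := fun t => g (p i) - g t) (by
        intro t ht
        rw [uIoc_of_le (hmono i)] at ht
        have h0 := (hmem i hi').1
        have h1 := hmem' i hi'
        refine hw _ (hmem i hi') _ ⟨h0.trans ht.1.le, ht.2.trans h1⟩ ?_
        rw [← hstep i, abs_sub_comm, abs_of_nonneg (by linarith [ht.1])]
        linarith [ht.2])
    rwa [Real.norm_eq_abs, abs_of_nonneg (by linarith [hmono i] : 0 ≤ p (i + 1) - p i),
      hstep] at this
  refine (Finset.sum_le_sum key).trans (le_of_eq ?_)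
  simp
  field_simp

lemma eventually_div_succ_le {T δ : ℝ} (hδ : 0 < δ) : ∀ᶠ n : ℕ in atTop, T / (n + 1) ≤ δ := by
  have h : Tendsto (fun n : ℕ => T * (1 / ((n : ℝ) + 1))) atTop (𝓝 (T * 0)) :=
    tendsto_one_div_add_atTop_nhds_zero_nat.const_mul T
  rw [mul_zero] at h
  filter_upwards [h.eventually (eventually_le_nhds hδ)] with n hn
  rwa [mul_one_div] at hn

lemma tendsto_riemannSum {T : ℝ} (hT : 0 < T) {g : ℝ → ℝ} (hg : Continuous g) :
    Tendsto (riemannSum T g) atTop (𝓝 (∫ t in (0 : ℝ)..T, g t)) := by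
  rw [Metric.tendsto_nhds]
  intro e he
  have huc := Metric.uniformContinuousOn_iff_le.1
    ((isCompact_Icc (a := (0 : ℝ)) (b := T)).uniformContinuousOn_of_continuous hg.continuousOn)
  obtain ⟨δ, hδ, h⟩ := huc (e / (2 * T)) (by positivity)
  filter_upwards [eventually_div_succ_le (T := T) hδ] with n hn
  refine (abs_riemannSum_sub_integral_le hT hg (w := e / (2 * T)) fun x hx y hy hxy =>
    h x hx y hy (hxy.trans hn)).trans_lt ?_
  field_simp
  norm_num

/-- Uniform continuity on the square makes the inner sums converge to the inner integrals uniformly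
in t, so they may be exchanged inside the outer sum. -/
lemma tendsto_riemannSum_riemannSum {T : ℝ} (hT : 0 < T) {G : ℝ → ℝ → ℝ}
    (hG : Continuous fun p : ℝ × ℝ => G p.1 p.2) :
    Tendsto (fun n => riemannSum T (fun t => riemannSum T (G t) n) n) atTop
      (𝓝 (∫ t in (0 : ℝ)..T, ∫ s in (0 : ℝ)..T, G t s)) := by
  have hK : Continuous fun t => ∫ s in (0 : ℝ)..T, G t s :=
    intervalIntegral.continuous_parametric_intervalIntegral_of_continuous' hG 0 T
  have h1 := tendsto_riemannSum hT hK
  refine h1.congr_dist ?_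
  rw [Metric.tendsto_nhds]
  intro e he
  have huc := Metric.uniformContinuousOn_iff_le.1
    ((isCompact_Icc (a := (0 : ℝ)) (b := T)).prod
      (isCompact_Icc (a := (0 : ℝ)) (b := T)) |>.uniformContinuousOn_of_continuous
        hG.continuousOn)
  obtain ⟨δ, hδ, h⟩ := huc (e / (2 * T * T)) (by positivity)
  filter_upwards [eventually_div_succ_le (T := T) hδ] with n hn
  have hin : ∀ t ∈ Icc 0 T, |(∫ s in (0 : ℝ)..T, G t s) - riemannSum T (G t) n|
      ≤ T * (e / (2 * T * T)) := by
    intro t ht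
    rw [abs_sub_comm]
    have hGt : Continuous (G t) :=
      hG.comp (continuous_const.prodMk continuous_id)
    refine abs_riemannSum_sub_integral_le hT hGt fun x hx y hy hxy => ?_
    refine h (t, x) ⟨ht, hx⟩ (t, y) ⟨ht, hy⟩ ?_
    rw [Prod.dist_eq]
    simp only [dist_self]
    exact max_le hδ.le (hxy.trans hn)
  rw [Real.dist_0_eq_abs, Real.dist_eq, abs_abs]
  refine (riemannSum_mono_abs hT hin n).trans_lt ?_
  field_simp
  norm_num

/-! ### The covariance function and integrals of the noise -/

section Noise

variable {Ω : Type*} [MeasurableSpace Ω] {P : Measure Ω} {ε : ℝ → Ω → ℝ}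

/-- Mean-square continuity says that t ↦ ε(t) is a continuous curve in L²(P), and the covariance is
the inner product along it. -/
lemma IsContinuousCentredNoise.continuous_covFun (h : IsContinuousCentredNoise P ε) :
    Continuous fun p : ℝ × ℝ => covFun P ε p.1 p.2 := by
  set φ : ℝ → Lp ℝ 2 P := fun t => (h.memLp_two t).toLp (ε t) with hφ
  have hinner : ∀ t s, covFun P ε t s = inner ℝ (φ t) (φ s) := by
    intro t s
    rw [L2.inner_def, covFun]
    refine integral_congr_ae ?_
    filter_upwards [(h.memLp_two t).coeFn_toLp, (h.memLp_two s).coeFn_toLp] with ω h1 h2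
    simp only [hφ, h1, h2]
    simp [mul_comm]
  have hφc : Continuous φ := by
    rw [continuous_iff_continuousAt]
    intro t₀
    rw [ContinuousAt, tendsto_iff_norm_sub_tendsto_zero]
    have hsq : ∀ t, ∫ ω, (ε t ω - ε t₀ ω) ^ 2 ∂P = ‖φ t - φ t₀‖ ^ 2 := by
      intro t
      rw [← real_inner_self_eq_norm_sq, L2.inner_def]
      refine integral_congr_ae ?_
      filter_upwards [(h.memLp_two t).coeFn_toLp, (h.memLp_two t₀).coeFn_toLp,
        Lp.coeFn_sub (φ t) (φ t₀)] with ω h1 h2 h3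
      rw [h3]
      simp only [hφ, Pi.sub_apply, h1, h2]
      simp [sq]
    have := (h.mean_square_continuous t₀).sqrt
    simpa [hsq, Real.sqrt_sq (norm_nonneg _)] using this
  simp only [hinner]
  exact (hφc.comp continuous_fst).inner (hφc.comp continuous_snd)

lemma ae_tendsto_riemannSum (h : IsContinuousCentredNoise P ε) {T : ℝ} (hT : 0 < T)
    {f : ℝ → ℝ} (hf : Continuous f) :
    ∀ᵐ ω ∂P, Tendsto (fun n => riemannSum T (fun t => ε t ω * f t) n) atTop
      (𝓝 (∫ t in (0 : ℝ)..T, ε t ω * f t)) := by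
  filter_upwards [h.ae_continuous] with ω hω
  exact tendsto_riemannSum hT (hω.mul hf)

lemma measurable_riemannSum (h : IsContinuousCentredNoise P ε) (T : ℝ) (f : ℝ → ℝ) (n : ℕ) :
    Measurable fun ω => riemannSum T (fun t => ε t ω * f t) n := by
  unfold riemannSum
  exact Finset.measurable_sum _ fun i _ => ((h.measurable _).mul_const _).const_mul _

lemma aemeasurable_integral_noise (h : IsContinuousCentredNoise P ε) {T : ℝ} (hT : 0 < T)
    {f : ℝ → ℝ} (hf : Continuous f) :
    AEMeasurable (fun ω => ∫ t in (0 : ℝ)..T, ε t ω * f t) P :=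
  aemeasurable_of_tendsto_metrizable_ae atTop
    (fun n => (measurable_riemannSum h T f n).aemeasurable) (ae_tendsto_riemannSum h hT hf)

lemma lintegral_exp_riemannSum_le (h : IsJointlyStrictlySubGaussian P ε) (T : ℝ) (f : ℝ → ℝ)
    (n : ℕ) :
    ∫⁻ ω, ENNReal.ofReal (Real.exp (riemannSum T (fun t => ε t ω * f t) n)) ∂P ≤
      ENNReal.ofReal (Real.exp (1 / 2 * riemannSum T
        (fun t => riemannSum T (fun s => covFun P ε t s * f t * f s) n) n)) := by
  obtain ⟨hi, hle⟩ := h (n + 1) (fun i => T * i / (n + 1))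
    (fun i => T / (n + 1) * f (T * i / (n + 1)))
  have h1 : ∀ ω, riemannSum T (fun t => ε t ω * f t) n = ∑ i : Fin (n + 1),
      ε (T * i / (n + 1)) ω * (T / (n + 1) * f (T * i / (n + 1))) := by
    intro ω
    unfold riemannSum
    exact Finset.sum_congr rfl fun i _ => by ring
  have h2 : riemannSum T (fun t => riemannSum T (fun s => covFun P ε t s * f t * f s) n) n
      = ∑ i : Fin (n + 1), ∑ j : Fin (n + 1),
        (∫ ω, ε (T * i / (n + 1)) ω * ε (T * j / (n + 1)) ω ∂P) *
          (T / (n + 1) * f (T * i / (n + 1))) * (T / (n + 1) * f (T * j / (n + 1))) := by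
    unfold riemannSum covFun
    refine Finset.sum_congr rfl fun i _ => ?_
    rw [Finset.mul_sum]
    exact Finset.sum_congr rfl fun j _ => by ring
  simp only [h1, h2]
  rw [← ofReal_integral_eq_lintegral_ofReal hi (ae_of_all _ fun ω => (Real.exp_pos _).le)]
  exact ENNReal.ofReal_le_ofReal hle

/-- Fatou's lemma carries the finite-dimensional bound along Riemann sums. The discrete quadratic
forms converge to the covariance form of f, which is at most d₀∫f². -/
lemma lintegral_exp_integral_noise_le (h : IsContinuousCentredNoise P ε) {d₀ : ℝ}
    (h' : IsSubGaussianNoise P ε d₀) {T : ℝ} (hT : 0 < T) {f : ℝ → ℝ} (hf : Continuous f) :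
    ∫⁻ ω, ENNReal.ofReal (Real.exp (∫ t in (0 : ℝ)..T, ε t ω * f t)) ∂P ≤
      ENNReal.ofReal (Real.exp (1 / 2 * (d₀ * ∫ t in (0 : ℝ)..T, f t ^ 2))) := by
  set A : ℝ := ∫ t in (0 : ℝ)..T, ∫ s in (0 : ℝ)..T, covFun P ε t s * f t * f s with hA
  have hA_le : A ≤ d₀ * ∫ t in (0 : ℝ)..T, f t ^ 2 := by
    refine h'.cov_bound T hT f ?_
    rw [memLp_two_iff_integrable_sq hf.aestronglyMeasurable]
    exact (hf.pow 2).continuousOn.integrableOn_compact isCompact_Icc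
  have hlim : Tendsto (fun n => ENNReal.ofReal (Real.exp (1 / 2 * riemannSum T
        (fun t => riemannSum T (fun s => covFun P ε t s * f t * f s) n) n))) atTop
      (𝓝 (ENNReal.ofReal (Real.exp (1 / 2 * A)))) := by
    have hG : Continuous fun p : ℝ × ℝ => covFun P ε p.1 p.2 * f p.1 * f p.2 :=
      (h.continuous_covFun.mul (hf.comp continuous_fst)).mul (hf.comp continuous_snd)
    have := tendsto_riemannSum_riemannSum hT (G := fun t s => covFun P ε t s * f t * f s) hG
    exact ENNReal.tendsto_ofReal
      ((Real.continuous_exp.tendsto _).comp (this.const_mul (1 / 2)))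
  calc ∫⁻ ω, ENNReal.ofReal (Real.exp (∫ t in (0 : ℝ)..T, ε t ω * f t)) ∂P
      = ∫⁻ ω, liminf (fun n => ENNReal.ofReal
          (Real.exp (riemannSum T (fun t => ε t ω * f t) n))) atTop ∂P := by
        refine lintegral_congr_ae ?_
        filter_upwards [ae_tendsto_riemannSum h hT hf] with ω hω
        exact (ENNReal.tendsto_ofReal
          ((Real.continuous_exp.tendsto _).comp hω)).liminf_eq.symm
    _ ≤ liminf (fun n => ∫⁻ ω, ENNReal.ofReal
          (Real.exp (riemannSum T (fun t => ε t ω * f t) n)) ∂P) atTop :=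
        lintegral_liminf_le' fun n =>
          (Real.measurable_exp.comp (measurable_riemannSum h T f n)).ennreal_ofReal.aemeasurable
    _ ≤ liminf (fun n => ENNReal.ofReal (Real.exp (1 / 2 * riemannSum T
        (fun t => riemannSum T (fun s => covFun P ε t s * f t * f s) n) n))) atTop :=
        liminf_le_liminf (Eventually.of_forall fun n =>
          lintegral_exp_riemannSum_le h'.jointly_sub_gaussian T f n)
    _ = ENNReal.ofReal (Real.exp (1 / 2 * A)) := hlim.liminf_eq
    _ ≤ _ := by gcongr

/-- Sub-Gaussian tail of a weighted integral of the noise. -/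
lemma measure_integral_noise_ge_le (h : IsContinuousCentredNoise P ε) {d₀ : ℝ}
    (h' : IsSubGaussianNoise P ε d₀) {T : ℝ} (hT : 0 < T) {f : ℝ → ℝ}
    (hf : ContinuousOn f (Icc 0 T)) {W : ℝ} (hW : 0 < W)
    (hfW : d₀ * ∫ t in (0 : ℝ)..T, f t ^ 2 ≤ W) {x : ℝ}
    (hx : 0 ≤ x) :
    P {ω | x ≤ ∫ t in (0 : ℝ)..T, ε t ω * f t} ≤
      ENNReal.ofReal (Real.exp (-(x ^ 2 / (2 * W)))) := by
  -- This c minimizes the Chernoff exponent c²W/2 − cx.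
  set c : ℝ := x / W with hc
  have hc0 : 0 ≤ c := by positivity
  -- Constant extension beyond [0, T] gives continuity on ℝ without changing the integrals.
  set g : ℝ → ℝ := fun t => c * IccExtend hT.le (domRestrict (Icc 0 T) f) t with hg
  have hgc : Continuous g := continuous_const.mul hf.domRestrict.Icc_extend'
  have hgf : ∀ t ∈ uIcc 0 T, g t = c * f t := by
    intro t ht
    rw [uIcc_of_le hT.le] at ht
    simp only [hg]
    rw [IccExtend_of_mem _ _ ht]
    rfl
  have h1 : ∀ ω, ∫ t in (0 : ℝ)..T, ε t ω * g t = c * ∫ t in (0 : ℝ)..T, ε t ω * f t := by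
    intro ω
    rw [← intervalIntegral.integral_const_mul]
    refine intervalIntegral.integral_congr fun t ht => ?_
    simp only [hgf t ht]
    ring
  have h2 : ∫ t in (0 : ℝ)..T, g t ^ 2 = c ^ 2 * ∫ t in (0 : ℝ)..T, f t ^ 2 := by
    rw [← intervalIntegral.integral_const_mul]
    refine intervalIntegral.integral_congr fun t ht => ?_
    simp only [hgf t ht]
    ring
  have hlin := lintegral_exp_integral_noise_le h h' hT hgc
  have hmeas : AEMeasurable (fun ω => ENNReal.ofReal
      (Real.exp (∫ t in (0 : ℝ)..T, ε t ω * g t))) P :=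
    (Real.measurable_exp.comp_aemeasurable
      (aemeasurable_integral_noise h hT hgc)).ennreal_ofReal
  have hmk := (mul_meas_ge_le_lintegral₀ hmeas (ENNReal.ofReal (Real.exp (c * x)))).trans hlin
  have hsub : {ω | x ≤ ∫ t in (0 : ℝ)..T, ε t ω * f t} ⊆
      {ω | ENNReal.ofReal (Real.exp (c * x)) ≤
        ENNReal.ofReal (Real.exp (∫ t in (0 : ℝ)..T, ε t ω * g t))} := by
    intro ω hω
    simp only [mem_ofPred_eq] at hω ⊢
    rw [h1]
    gcongr
  have hpos : 0 < Real.exp (c * x) := Real.exp_pos _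
  have hdiv : P {ω | x ≤ ∫ t in (0 : ℝ)..T, ε t ω * f t} ≤
      ENNReal.ofReal (Real.exp (1 / 2 * (d₀ * ∫ t in (0 : ℝ)..T, g t ^ 2))) /
        ENNReal.ofReal (Real.exp (c * x)) := by
    rw [ENNReal.le_div_iff_mul_le (Or.inl (by simpa using hpos)) (Or.inl ENNReal.ofReal_ne_top),
      mul_comm]
    exact (mul_le_mul_right (measure_mono hsub) _).trans hmk
  refine hdiv.trans ?_
  rw [← ENNReal.ofReal_div_of_pos hpos, ← Real.exp_sub, h2]
  refine ENNReal.ofReal_le_ofReal (Real.exp_le_exp.2 ?_)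
  have h3 : 1 / 2 * (d₀ * (c ^ 2 * ∫ t in (0 : ℝ)..T, f t ^ 2)) ≤ 1 / 2 * (c ^ 2 * W) := by
    have := mul_le_mul_of_nonneg_left hfW (sq_nonneg c)
    linarith
  have h4 : 1 / 2 * (c ^ 2 * W) - c * x = -(x ^ 2 / (2 * W)) := by
    simp only [hc]
    field_simp
    ring
  linarith

end Noise

/-! ### Chaining -/

/-- Chaining bound for the oscillation of a process with sub-Gaussian increments along a
sequence of nested finite approximations with geometrically decreasing mesh. -/
theorem measure_exists_sub_ge_le_of_chain {Ω : Type*} [MeasurableSpace Ω] {P : Measure Ω}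
    [IsProbabilityMeasure P] {E : Type*} [NormedAddCommGroup E] {V : Set E} {η : E → Ω → ℝ}
    {σ D M : ℝ} (hσ : 0 < σ) (hD : 0 < D) (hM : 0 < M)
    (htail : ∀ u ∈ V, ∀ v ∈ V, ∀ ℓ > 0, ‖u - v‖ ≤ ℓ → ∀ x ≥ 0,
      P {ω | x ≤ η u ω - η v ω} ≤ ENNReal.ofReal (Real.exp (-(x ^ 2 / (2 * (σ * ℓ ^ 2))))))
    (hlip : ∀ᵐ ω ∂P, ∃ K, ∀ u ∈ V, ∀ v ∈ V, |η u ω - η v ω| ≤ K * ‖u - v‖)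
    {v₀ : E} {π : ℕ → E → E} {F : ℕ → Finset E} (hF : ∀ k, ∀ u ∈ V, π k u ∈ F k)
    (hFV : ∀ k, (F k : Set E) ⊆ V) (hcard : ∀ k, ((F k).card : ℝ) ≤ M ^ k)
    (hcomp : ∀ k, ∀ u ∈ V, π k (π (k + 1) u) = π k u) (h0 : ∀ u ∈ V, π 0 u = v₀)
    (hdist : ∀ k, ∀ u ∈ V, ‖u - π k u‖ ≤ D / 2 ^ k) {x : ℝ} (hx : 0 < x) :
    P {ω | ∃ u ∈ V, x ≤ η u ω - η v₀ ω} ≤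
      ENNReal.ofReal (2 * M * Real.exp (-(x ^ 2 / (128 * σ * D ^ 2)))) := by
  set y : ℝ := x ^ 2 / (128 * σ * D ^ 2) with hy
  have hy0 : 0 ≤ y := by positivity
  set r : ℝ := M * Real.exp (-y) with hr
  have hr0 : 0 < r := by positivity
  rw [show 2 * M * Real.exp (-y) = 2 * r by rw [hr]; ring]
  -- For r > 1/2 the claimed bound exceeds 1; otherwise the geometric series of ratio r sums to at
  -- most 2r.
  rcases lt_or_ge (1 / 2) r with hr1 | hr1
  · refine prob_le_one.trans ?_
    rw [← ENNReal.ofReal_one]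
    exact ENNReal.ofReal_le_ofReal (by linarith)
  -- The thresholds sum to x/2. They decay slower than the mesh 2⁻ᵏ, so the exponents grow like
  -- (9/4)ᵏ and beat the cardinalities Mᵏ⁺¹.
  set link : ℕ → E → Set Ω := fun k w => {ω | x / 8 * (3 / 4) ^ k ≤ η w ω - η (π k w) ω}
    with hlink
  have hπV : ∀ k, ∀ u ∈ V, π k u ∈ V := fun k u hu => hFV k (hF k u hu)
  have hlinkP : ∀ k, ∀ w ∈ F (k + 1), P (link k w) ≤ ENNReal.ofReal (Real.exp (-y) ^ (k + 1)) := by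
    intro k w hw
    have hwV := hFV _ hw
    refine (htail w hwV (π k w) (hπV k w hwV) (D / 2 ^ k) (by positivity) (hdist k w hwV) _
      (by positivity)).trans (ENNReal.ofReal_le_ofReal ?_)
    rw [← Real.exp_nat_mul]
    refine Real.exp_le_exp.2 ?_
    have h1 : (x / 8 * (3 / 4) ^ k) ^ 2 / (2 * (σ * (D / 2 ^ k) ^ 2)) = y * (9 / 4 : ℝ) ^ k := by
      rw [hy, show (9 / 4 : ℝ) ^ k = ((3 / 4) ^ k) ^ 2 * (2 ^ k) ^ 2 by
        rw [← pow_mul, ← pow_mul, mul_comm k 2, pow_mul, pow_mul, ← mul_pow]; norm_num]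
      field_simp
      norm_num
    have h2 : (k : ℝ) + 1 ≤ (9 / 4 : ℝ) ^ k := by
      have := one_add_mul_le_pow (a := (5 / 4 : ℝ)) (by norm_num) k
      norm_num at this
      have hk : (0 : ℝ) ≤ k := by positivity
      linarith
    rw [h1]
    push_cast
    have := mul_le_mul_of_nonneg_left h2 hy0
    linarith
  have hUnion : P (⋃ k, ⋃ w ∈ F (k + 1), link k w) ≤ ENNReal.ofReal (2 * r) := by
    have hk : ∀ k, P (⋃ w ∈ F (k + 1), link k w) ≤ ENNReal.ofReal (r * r ^ k) := by
      intro k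
      refine (measure_biUnion_finset_le _ _).trans ((Finset.sum_le_sum (hlinkP k)).trans ?_)
      rw [Finset.sum_const, nsmul_eq_mul, ← ENNReal.ofReal_natCast,
        ← ENNReal.ofReal_mul (by positivity)]
      refine ENNReal.ofReal_le_ofReal ?_
      rw [← pow_succ', hr, mul_pow]
      exact mul_le_mul_of_nonneg_right (hcard _) (by positivity)
    have hgeo := (hasSum_geometric_of_lt_one hr0.le (by linarith : r < 1)).mul_left r
    refine (measure_iUnion_le _).trans ((ENNReal.tsum_le_tsum hk).trans ?_)
    rw [← ENNReal.ofReal_tsum_of_nonneg (fun k => by positivity) hgeo.summable, hgeo.tsum_eq]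
    refine ENNReal.ofReal_le_ofReal ?_
    rw [← div_eq_mul_inv, div_le_iff₀ (by linarith)]
    nlinarith
  refine (measure_mono_ae ?_).trans hUnion
  filter_upwards [hlip] with ω ⟨K, hK⟩ ⟨u, hu, hxu⟩
  by_contra hcon
  change ω ∉ ⋃ k, ⋃ w ∈ F (k + 1), link k w at hcon
  simp only [hlink, mem_iUnion, mem_ofPred_eq, not_exists, not_le] at hcon
  have hchain : ∀ n, η (π n u) ω - η v₀ ω ≤ x / 2 * (1 - (3 / 4) ^ n) := by
    intro n
    induction n with
    | zero => simp [h0 u hu]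
    | succ n ih =>
      have := hcon n (π (n + 1) u) (hF _ u hu)
      rw [hcomp n u hu] at this
      rw [pow_succ]
      linarith
  -- The other x/2 covers the remainder η(u) − η(πₙu). The random Lipschitz constant only decides
  -- how large n must be, so it does not enter the bound.
  have hlim : Tendsto (fun n : ℕ => |K| * D * (1 / 2 : ℝ) ^ n) atTop (𝓝 (|K| * D * 0)) :=
    (tendsto_pow_atTop_nhds_zero_of_lt_one (by norm_num) (by norm_num)).const_mul _
  rw [mul_zero] at hlim
  obtain ⟨n, hn⟩ := (hlim.eventually (gt_mem_nhds (half_pos hx))).exists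
  have h1 : η u ω - η (π n u) ω ≤ |K| * D * (1 / 2) ^ n :=
    calc η u ω - η (π n u) ω ≤ |η u ω - η (π n u) ω| := le_abs_self _
      _ ≤ K * ‖u - π n u‖ := hK u hu _ (hπV n u hu)
      _ ≤ |K| * (D / 2 ^ n) :=
        mul_le_mul (le_abs_self K) (hdist n u hu) (norm_nonneg _) (abs_nonneg _)
      _ = |K| * D * (1 / 2) ^ n := by rw [one_div, inv_pow]; ring
  have h2 := hchain n
  have h3 : 0 ≤ x / 2 * (3 / 4 : ℝ) ^ n := by positivity
  linarith

/-! ### Dyadic cells -/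

/-- Index of the dyadic cube of side `2⁻ᵏ` that contains `u`. -/
def dyadicCell {q : ℕ} (k : ℕ) (u : EuclideanSpace ℝ (Fin q)) : Fin q → ℤ :=
  fun i => ⌊2 ^ k * u i⌋

lemma floor_le_floor_of_floor_two_mul {x y : ℝ} (h : ⌊2 * x⌋ = ⌊2 * y⌋) : ⌊x⌋ ≤ ⌊y⌋ := by
  rw [Int.le_floor]
  have h1 : 2 * ⌊x⌋ ≤ ⌊2 * x⌋ := by
    rw [Int.le_floor]
    push_cast
    linarith [Int.floor_le x]
  rw [h, Int.le_floor] at h1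
  push_cast at h1
  linarith

/-- Dyadic cubes are nested; this makes the successive approximations in the chain compatible. -/
lemma dyadicCell_eq_of_succ {q k : ℕ} {u v : EuclideanSpace ℝ (Fin q)}
    (h : dyadicCell (k + 1) u = dyadicCell (k + 1) v) : dyadicCell k u = dyadicCell k v := by
  ext i
  have hi : ⌊2 * (2 ^ k * u i)⌋ = ⌊2 * (2 ^ k * v i)⌋ := by
    have := congrFun h i
    simp only [dyadicCell, pow_succ'] at this
    simpa only [mul_assoc] using this
  exact le_antisymm (floor_le_floor_of_floor_two_mul hi) (floor_le_floor_of_floor_two_mul hi.symm)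

lemma norm_sub_le_of_dyadicCell_eq {q k : ℕ} {u v : EuclideanSpace ℝ (Fin q)}
    (h : dyadicCell k u = dyadicCell k v) : ‖u - v‖ ≤ √q / 2 ^ k := by
  rw [EuclideanSpace.norm_eq, Real.sqrt_le_left (by positivity), div_pow,
    Real.sq_sqrt (by positivity)]
  have : ∀ i ∈ (Finset.univ : Finset (Fin q)), ‖(u - v) i‖ ^ 2 ≤ 1 / (2 ^ k) ^ 2 := by
    intro i _
    have h1 := (Int.abs_sub_lt_one_of_floor_eq_floor (congrFun h i)).le
    rw [← mul_sub, abs_mul, abs_of_pos (by positivity)] at h1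
    rw [← one_div_pow]
    refine pow_le_pow_left₀ (norm_nonneg _) ?_ 2
    rw [le_div_iff₀ (by positivity), mul_comm]
    exact h1
  refine (Finset.sum_le_sum this).trans (le_of_eq ?_)
  simp
  rfl

/-- Oscillation, over the part of `U` in a unit cube, of a process with sub-Gaussian
increments. -/
theorem exists_measure_cube_oscillation_le {Ω : Type*} [MeasurableSpace Ω] {P : Measure Ω}
    [IsProbabilityMeasure P] {q : ℕ} (hq : 0 < q) {U : Set (EuclideanSpace ℝ (Fin q))}
    {η : EuclideanSpace ℝ (Fin q) → Ω → ℝ} {σ : ℝ} (hσ : 0 < σ)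
    (htail : ∀ u ∈ U, ∀ v ∈ U, ∀ ℓ > 0, ‖u - v‖ ≤ ℓ → ∀ x ≥ 0,
      P {ω | x ≤ η u ω - η v ω} ≤ ENNReal.ofReal (Real.exp (-(x ^ 2 / (2 * (σ * ℓ ^ 2))))))
    (hlip : ∀ᵐ ω ∂P, ∃ K, ∀ u ∈ U, ∀ v ∈ U, |η u ω - η v ω| ≤ K * ‖u - v‖)
    {z : Fin q → ℤ} (hz : ∃ u ∈ U, dyadicCell 0 u = z) :
    ∃ v₀ ∈ U, dyadicCell 0 v₀ = z ∧ ∀ x > 0,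
      P {ω | ∃ u ∈ U, dyadicCell 0 u = z ∧ x ≤ η u ω - η v₀ ω} ≤
        ENNReal.ofReal (2 * 2 ^ q * Real.exp (-(x ^ 2 / (128 * σ * q)))) := by
  classical
  set V : Set (EuclideanSpace ℝ (Fin q)) := {u | u ∈ U ∧ dyadicCell 0 u = z} with hV
  have hVU : ∀ {u}, u ∈ V → u ∈ U := fun hu => hu.1
  -- Representatives are taken inside V, because tails are known only there, and depend only on the
  -- cell, so a level has at most as many as it has cells.
  set rep : ℕ → (Fin q → ℤ) → EuclideanSpace ℝ (Fin q) := fun k c =>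
    Classical.epsilon fun w => w ∈ V ∧ dyadicCell k w = c with hrep
  have hrep_spec : ∀ k c, (∃ w ∈ V, dyadicCell k w = c) →
      rep k c ∈ V ∧ dyadicCell k (rep k c) = c := fun k c h =>
    Classical.epsilon_spec (p := fun w => w ∈ V ∧ dyadicCell k w = c) h
  have hu_spec : ∀ k, ∀ u ∈ V, rep k (dyadicCell k u) ∈ V ∧
      dyadicCell k (rep k (dyadicCell k u)) = dyadicCell k u := fun k u hu =>
    hrep_spec k _ ⟨u, hu, rfl⟩
  set box : ℕ → Finset (Fin q → ℤ) := fun k =>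
    Fintype.piFinset fun i => Finset.Ico (2 ^ k * z i) (2 ^ k * (z i + 1)) with hbox
  have hmem_box : ∀ k, ∀ u ∈ V, dyadicCell k u ∈ box k := by
    intro k u hu
    simp only [hbox, Fintype.mem_piFinset, Finset.mem_Ico]
    intro i
    have hi : ⌊u i⌋ = z i := by simpa [dyadicCell] using congrFun hu.2 i
    obtain ⟨h1, h2⟩ := Int.floor_eq_iff.1 hi
    refine ⟨?_, ?_⟩
    · rw [dyadicCell, Int.le_floor]
      push_cast
      gcongr
    · rw [dyadicCell, Int.floor_lt]
      push_cast
      gcongr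
  set F : ℕ → Finset (EuclideanSpace ℝ (Fin q)) := fun k =>
    ((box k).filter fun c => ∃ w ∈ V, dyadicCell k w = c).image (rep k) with hF
  obtain ⟨u₁, hu₁U, hu₁z⟩ := hz
  have hu₁ : u₁ ∈ V := ⟨hu₁U, hu₁z⟩
  obtain ⟨hv₀, hv₀z⟩ := hrep_spec 0 z ⟨u₁, hu₁, hu₁z⟩
  refine ⟨rep 0 z, hVU hv₀, hv₀z, fun x hx => ?_⟩
  have hq' : (0 : ℝ) < √q := Real.sqrt_pos.2 (by exact_mod_cast hq)
  have := measure_exists_sub_ge_le_of_chain (P := P) (V := V) (η := η) (M := 2 ^ q)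
    (v₀ := rep 0 z) (π := fun k u => rep k (dyadicCell k u)) (F := F) hσ hq' (by positivity)
    (fun u hu v hv => htail u (hVU hu) v (hVU hv))
    (hlip.mono fun ω ⟨K, hK⟩ => ⟨K, fun u hu v hv => hK u (hVU hu) v (hVU hv)⟩)
    (fun k u hu => Finset.mem_image_of_mem _
      (Finset.mem_filter.2 ⟨hmem_box k u hu, u, hu, rfl⟩))
    (fun k w hw => by
      simp only [hF, Finset.coe_image, mem_image, Finset.mem_coe, Finset.mem_filter] at hw
      obtain ⟨c, ⟨_, hc⟩, rfl⟩ := hw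
      exact (hrep_spec k c hc).1)
    (fun k => by
      have h1 : (F k).card ≤ (box k).card :=
        Finset.card_image_le.trans (Finset.card_filter_le _ _)
      have h2 : (box k).card = (2 ^ k) ^ q := by
        simp only [hbox, Fintype.card_piFinset, Int.card_Ico]
        have h3 : ∀ i, (2 ^ k * (z i + 1) - 2 ^ k * z i).toNat = 2 ^ k := by
          intro i
          rw [mul_add, mul_one, add_sub_cancel_left]
          exact_mod_cast Int.toNat_natCast (2 ^ k)
        simp [h3]
      rw [h2] at h1
      rw [← pow_mul, mul_comm, pow_mul]
      exact_mod_cast h1)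
    (fun k u hu => congrArg (rep k) (dyadicCell_eq_of_succ (hu_spec (k + 1) u hu).2))
    (fun u hu => congrArg (rep 0) hu.2)
    (fun k u hu => norm_sub_le_of_dyadicCell_eq (hu_spec k u hu).2.symm) hx
  rw [Real.sq_sqrt (by positivity)] at this
  refine le_trans (measure_mono ?_) this
  rintro ω ⟨u, hu, huz, hxu⟩
  exact ⟨u, ⟨hu, huz⟩, hxu⟩

/-! ### Gaussian sums over the integer lattice -/

lemma summable_exp_neg_mul_int_sq {κ : ℝ} (hκ : 0 < κ) :
    Summable fun n : ℤ => Real.exp (-(κ * (n : ℝ) ^ 2)) := by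
  have h : Summable fun n : ℕ => Real.exp (-(κ * (n : ℝ) ^ 2)) := by
    refine Summable.of_nonneg_of_le (fun n => (Real.exp_pos _).le) (fun n => ?_)
      (summable_geometric_of_lt_one (Real.exp_pos (-κ)).le (by rw [Real.exp_lt_one_iff]; linarith))
    rw [← Real.exp_nat_mul]
    refine Real.exp_le_exp.2 ?_
    have hn : (n : ℝ) ≤ (n : ℝ) ^ 2 := by exact_mod_cast Nat.le_self_pow two_ne_zero n
    nlinarith
  refine Summable.of_nat_of_neg ?_ ?_ <;> simpa using h

/-- A finite set of multi-indices lies in the product of its coordinate projections, over which the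
sum factors. -/
lemma tsum_prod_ofReal_le {ι α : Type*} [Fintype ι] {f : α → ℝ} (hf : ∀ n, 0 ≤ f n)
    (hs : Summable f) :
    ∑' z : ι → α, ENNReal.ofReal (∏ i, f (z i)) ≤
      ENNReal.ofReal ((∑' n, f n) ^ Fintype.card ι) := by
  classical
  rw [ENNReal.tsum_eq_iSup_sum]
  refine iSup_le fun S => ?_
  rw [← ENNReal.ofReal_sum_of_nonneg fun z _ => Finset.prod_nonneg fun i _ => hf _]
  refine ENNReal.ofReal_le_ofReal ?_
  set t : ι → Finset α := fun i => S.image fun z => z i with ht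
  have hsub : S ⊆ Fintype.piFinset t := by
    intro z hz
    rw [Fintype.mem_piFinset]
    exact fun i => Finset.mem_image_of_mem _ hz
  calc ∑ z ∈ S, ∏ i, f (z i)
      ≤ ∑ z ∈ Fintype.piFinset t, ∏ i, f (z i) :=
        Finset.sum_le_sum_of_subset_of_nonneg hsub fun z _ _ =>
          Finset.prod_nonneg fun i _ => hf _
    _ = ∏ i, ∑ n ∈ t i, f n := (Finset.prod_univ_sum t fun _ n => f n).symm
    _ ≤ ∏ _i : ι, ∑' n, f n :=
        Finset.prod_le_prod (fun i _ => Finset.sum_nonneg fun n _ => hf n)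
          fun i _ => hs.sum_le_tsum _ fun n _ => hf n
    _ = (∑' n, f n) ^ Fintype.card ι := by rw [Finset.prod_const, Finset.card_univ]

lemma sum_sq_floor_le {q : ℕ} (v : EuclideanSpace ℝ (Fin q)) :
    ∑ i, (dyadicCell 0 v i : ℝ) ^ 2 ≤ 2 * ‖v‖ ^ 2 + 2 * q := by
  rw [EuclideanSpace.real_norm_sq_eq, Finset.mul_sum]
  have : ∀ i ∈ (Finset.univ : Finset (Fin q)),
      (dyadicCell 0 v i : ℝ) ^ 2 ≤ 2 * v i ^ 2 + 2 := by
    intro i _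
    simp only [dyadicCell, pow_zero, one_mul]
    have h1 := Int.floor_le (v i)
    have h2 := Int.lt_floor_add_one (v i)
    nlinarith [sq_nonneg (2 * v i - ⌊v i⌋)]
  refine (Finset.sum_le_sum this).trans (le_of_eq ?_)
  rw [Finset.sum_add_distrib]
  simp [mul_comm]

/-! ### Exceedance of half the drift far from the origin -/

/-- The budget 36κ‖v‖² splits into 34κ‖v‖², which covers bR² (a factor 17/16 absorbs the shift √q),
and 2κ‖v‖², which covers the lattice weight. -/
lemma exp_neg_norm_sq_le {q : ℕ} {b κ : ℝ} (hκ : 0 < κ) (hb : b ≤ 32 * κ) (hb0 : 0 ≤ b)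
    {v : EuclideanSpace ℝ (Fin q)} {R : ℝ} (hR : 0 ≤ R) (hRv : R ≤ ‖v‖ + √q) :
    Real.exp (-(36 * κ * ‖v‖ ^ 2)) ≤ Real.exp (17 * b * q + 2 * κ * q) *
      (Real.exp (-b * R ^ 2) * ∏ i, Real.exp (-(κ * (dyadicCell 0 v i : ℝ) ^ 2))) := by
  rw [← Real.exp_sum, ← Real.exp_add, ← Real.exp_add, Finset.sum_neg_distrib, ← Finset.mul_sum]
  refine Real.exp_le_exp.2 ?_
  have h1 := mul_le_mul_of_nonneg_left (sum_sq_floor_le v) hκ.le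
  have hq : √(q : ℝ) ^ 2 = q := Real.sq_sqrt (by positivity)
  have h2 : R ^ 2 ≤ 17 / 16 * ‖v‖ ^ 2 + 17 * q := by
    have := pow_le_pow_left₀ hR hRv 2
    nlinarith [sq_nonneg (‖v‖ / 4 - 4 * √q)]
  have h3 := mul_le_mul_of_nonneg_left h2 hb0
  have h4 := mul_le_mul_of_nonneg_right hb (by positivity : 0 ≤ 17 / 16 * ‖v‖ ^ 2)
  linarith

/-- A process with sub-Gaussian values and increments whose variance is comparable with the
squared norm exceeds half of its drift outside a large ball only with Gaussian probability. -/
theorem exists_measure_half_drift_le {Ω : Type*} [MeasurableSpace Ω] (P : Measure Ω)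
    [IsProbabilityMeasure P] {q : ℕ} (hq : 0 < q) {c₀ c₁ d₀ : ℝ} (hc₀ : 0 < c₀) (hc₁ : 0 < c₁)
    (hd₀ : 0 < d₀) :
    ∃ B > 0, ∀ (U : Set (EuclideanSpace ℝ (Fin q))) (η : EuclideanSpace ℝ (Fin q) → Ω → ℝ)
      (Φ : EuclideanSpace ℝ (Fin q) → ℝ),
      (∀ u ∈ U, c₀ * ‖u‖ ^ 2 ≤ Φ u) →
      (∀ u ∈ U, ∀ v ∈ U, 15 / 16 * Φ v ≤ Φ u + 15 * (c₁ * ‖u - v‖ ^ 2)) →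
      (∀ v ∈ U, 0 < Φ v → ∀ x ≥ 0,
        P {ω | x ≤ η v ω} ≤ ENNReal.ofReal (Real.exp (-(x ^ 2 / (2 * (d₀ * Φ v)))))) →
      (∀ u ∈ U, ∀ v ∈ U, ∀ ℓ > 0, ‖u - v‖ ≤ ℓ → ∀ x ≥ 0,
        P {ω | x ≤ η u ω - η v ω} ≤
          ENNReal.ofReal (Real.exp (-(x ^ 2 / (2 * (d₀ * c₁ * ℓ ^ 2)))))) →
      (∀ᵐ ω ∂P, ∃ K, ∀ u ∈ U, ∀ v ∈ U, |η u ω - η v ω| ≤ K * ‖u - v‖) →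
      ∀ R ≥ 0, P {ω | ∃ u ∈ U, R ≤ ‖u‖ ∧ 1 / 2 * Φ u ≤ η u ω} ≤
        ENNReal.ofReal (B * Real.exp (-(c₀ / (8 * d₀ * (1 + q))) * R ^ 2)) := by
  set b : ℝ := c₀ / (8 * d₀ * (1 + q)) with hb
  have hb0 : 0 < b := by positivity
  have hq0 : (0 : ℝ) < q := by exact_mod_cast hq
  have hq1 : (1 : ℝ) ≤ q := by exact_mod_cast hq
  -- Chosen so that 36κ = 9c₀/(128d₀), the pointwise rate at level 3Φ/8. Then 32κ = c₀/(16d₀)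
  -- dominates b because 1 + q ≥ 2.
  set κ : ℝ := c₀ / (512 * d₀) with hκdef
  have hκ : 0 < κ := by positivity
  have hbκ : b ≤ 32 * κ := by
    rw [hb, hκdef, div_le_iff₀ (by positivity)]
    field_simp
    linarith
  -- Beyond radius ρ the chaining exponent (c₀‖v‖²/16)²/(128d₀c₁q) is at least 36κ‖v‖²; 2304 = 9 ·
  -- 16².
  set ρ : ℝ := √(2304 * c₁ * q / c₀) with hρ
  have hρ2 : c₀ * ρ ^ 2 = 2304 * c₁ * q := by
    rw [hρ, Real.sq_sqrt (by positivity)]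
    field_simp
  have hρ0 : 0 < ρ := Real.sqrt_pos.2 (by positivity)
  set S : ℝ := ∑' n : ℤ, Real.exp (-(κ * (n : ℝ) ^ 2)) with hS
  have hS0 : 0 ≤ S := tsum_nonneg fun n => (Real.exp_pos _).le
  set K : ℝ := (1 + 2 * 2 ^ q) * Real.exp (17 * b * q + 2 * κ * q) with hK
  have hK0 : 0 < K := by positivity
  -- The first summand makes the bound trivial for R < ρ + √q; the second is the lattice sum.
  refine ⟨Real.exp (b * (ρ + √q) ^ 2) + K * S ^ q, by positivity, ?_⟩
  intro U η Φ hΦ hcomp hpt htail hlip R hR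
  rcases lt_or_ge R (ρ + √q) with hRlt | hRge
  · refine prob_le_one.trans ?_
    rw [← ENNReal.ofReal_one]
    refine ENNReal.ofReal_le_ofReal ?_
    have h1 : 1 ≤ Real.exp (b * (ρ + √q) ^ 2) * Real.exp (-b * R ^ 2) := by
      rw [← Real.exp_add, Real.one_le_exp_iff]
      have := mul_le_mul_of_nonneg_left (pow_le_pow_left₀ hR hRlt.le 2) hb0.le
      linarith
    have h2 : 0 ≤ K * S ^ q * Real.exp (-b * R ^ 2) := by positivity
    linarith
  set bad : (Fin q → ℤ) → Set Ω := fun z =>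
    {ω | ∃ u ∈ U, dyadicCell 0 u = z ∧ R ≤ ‖u‖ ∧ 1 / 2 * Φ u ≤ η u ω} with hbad
  have hbadP : ∀ z, P (bad z) ≤ ENNReal.ofReal (K * Real.exp (-b * R ^ 2)) *
      ENNReal.ofReal (∏ i, Real.exp (-(κ * (z i : ℝ) ^ 2))) := by
    intro z
    by_cases hz : ∃ u ∈ U, dyadicCell 0 u = z ∧ R ≤ ‖u‖
    swap
    · have : bad z = ∅ := by
        ext ω
        simp only [hbad, mem_ofPred_eq, mem_empty_iff_false, iff_false]
        rintro ⟨u, hu, huz, huR, -⟩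
        exact hz ⟨u, hu, huz, huR⟩
      simp [this]
    obtain ⟨u₁, hu₁, hu₁z, hu₁R⟩ := hz
    obtain ⟨v, hv, hvz, hosc⟩ := exists_measure_cube_oscillation_le hq
      (mul_pos hd₀ hc₁) htail hlip ⟨u₁, hu₁, hu₁z⟩
    have hclose : ∀ u, dyadicCell 0 u = z → ‖u - v‖ ≤ √q := fun u hu => by
      simpa using norm_sub_le_of_dyadicCell_eq (hu.trans hvz.symm)
    -- The representative v may itself lie inside the ball of radius R, but by no more than the
    -- cube's diameter.
    have hRv : R ≤ ‖v‖ + √q := by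
      have := norm_le_norm_add_norm_sub' u₁ v
      linarith [hclose u₁ hu₁z]
    have hvρ : ρ ≤ ‖v‖ := by linarith
    have hm : 2304 * c₁ * q ≤ c₀ * ‖v‖ ^ 2 := by
      rw [← hρ2]
      gcongr
    have hmpos : 0 < c₀ * ‖v‖ ^ 2 := lt_of_lt_of_le (by positivity) hm
    have hΦv := hΦ v hv
    have hΦpos : 0 < Φ v := hmpos.trans_le hΦv
    set A₁ : Set Ω := {ω | 3 / 8 * Φ v ≤ η v ω} with hA₁
    set A₂ : Set Ω := {ω | ∃ u ∈ U, dyadicCell 0 u = z ∧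
      c₀ * ‖v‖ ^ 2 / 16 ≤ η u ω - η v ω} with hA₂
    have hsub : bad z ⊆ A₁ ∪ A₂ := by
      rintro ω ⟨u, hu, huz, -, hu2⟩
      rw [mem_union, or_iff_not_imp_left]
      intro hω
      simp only [hA₁, mem_ofPred_eq, not_le] at hω
      refine ⟨u, hu, huz, ?_⟩
      -- Since η(u) ≥ 15Φ(v)/32 − 15c₁q/2 and η(v) < 12Φ(v)/32, the gap exceeds 3Φ(v)/32 − 15c₁q/2,
      -- which `hm` keeps above c₀‖v‖²/16.
      have h1 := hcomp u hu v hv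
      have h2 : ‖u - v‖ ^ 2 ≤ q := by
        have := pow_le_pow_left₀ (norm_nonneg _) (hclose u huz) 2
        rwa [Real.sq_sqrt hq0.le] at this
      have h3 := mul_le_mul_of_nonneg_left h2 hc₁.le
      linarith
    have hexp : 36 * κ * ‖v‖ ^ 2 = 9 * (c₀ * ‖v‖ ^ 2) / (128 * d₀) := by
      rw [hκdef]
      field_simp
      ring
    have hA₁P : P A₁ ≤ ENNReal.ofReal (Real.exp (-(36 * κ * ‖v‖ ^ 2))) := by
      refine (hpt v hv hΦpos _ (by positivity)).trans
        (ENNReal.ofReal_le_ofReal (Real.exp_le_exp.2 (neg_le_neg ?_)))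
      have : (3 / 8 * Φ v) ^ 2 / (2 * (d₀ * Φ v)) = 9 * Φ v / (128 * d₀) := by
        field_simp
        norm_num
      rw [this, hexp]
      gcongr
    have hA₂P : P A₂ ≤ ENNReal.ofReal (2 * 2 ^ q * Real.exp (-(36 * κ * ‖v‖ ^ 2))) := by
      refine (hosc _ (by positivity)).trans (ENNReal.ofReal_le_ofReal ?_)
      refine mul_le_mul_of_nonneg_left (Real.exp_le_exp.2 (neg_le_neg ?_)) (by positivity)
      rw [hexp, div_le_div_iff₀ (by positivity) (by positivity)]
      have := mul_le_mul_of_nonneg_left hm (by positivity : 0 ≤ c₀ * ‖v‖ ^ 2 * d₀ / 2)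
      linarith
    have hfin := exp_neg_norm_sq_le hκ hbκ hb0.le hR hRv
    rw [hvz] at hfin
    calc P (bad z) ≤ P A₁ + P A₂ := (measure_mono hsub).trans (measure_union_le _ _)
      _ ≤ _ := add_le_add hA₁P hA₂P
      _ = ENNReal.ofReal ((1 + 2 * 2 ^ q) * Real.exp (-(36 * κ * ‖v‖ ^ 2))) := by
        rw [← ENNReal.ofReal_add (by positivity) (by positivity)]
        congr 1
        ring
      _ ≤ ENNReal.ofReal (K * Real.exp (-b * R ^ 2) *
            ∏ i, Real.exp (-(κ * (z i : ℝ) ^ 2))) := by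
        refine ENNReal.ofReal_le_ofReal ?_
        rw [hK, mul_assoc _ _ (∏ i, _), mul_assoc (1 + 2 * 2 ^ q)]
        exact mul_le_mul_of_nonneg_left hfin (by positivity)
      _ = _ := ENNReal.ofReal_mul (by positivity)
  have hcover : {ω | ∃ u ∈ U, R ≤ ‖u‖ ∧ 1 / 2 * Φ u ≤ η u ω} ⊆ ⋃ z, bad z := by
    rintro ω ⟨u, hu, huR, hu2⟩
    exact mem_iUnion.2 ⟨dyadicCell 0 u, u, hu, rfl, huR, hu2⟩
  calc P {ω | ∃ u ∈ U, R ≤ ‖u‖ ∧ 1 / 2 * Φ u ≤ η u ω}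
      ≤ ∑' z, P (bad z) := (measure_mono hcover).trans (measure_iUnion_le _)
    _ ≤ _ := ENNReal.tsum_le_tsum hbadP
    _ = ENNReal.ofReal (K * Real.exp (-b * R ^ 2)) *
        ∑' z : Fin q → ℤ, ENNReal.ofReal (∏ i, Real.exp (-(κ * (z i : ℝ) ^ 2))) :=
      ENNReal.tsum_mul_left
    _ ≤ ENNReal.ofReal (K * Real.exp (-b * R ^ 2)) * ENNReal.ofReal (S ^ q) := by
      gcongr
      simpa using tsum_prod_ofReal_le (ι := Fin q) (fun n : ℤ => (Real.exp_pos _).le)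
        (summable_exp_neg_mul_int_sq hκ)
    _ = ENNReal.ofReal (K * Real.exp (-b * R ^ 2) * S ^ q) :=
      (ENNReal.ofReal_mul (by positivity)).symm
    _ ≤ _ := by
      refine ENNReal.ofReal_le_ofReal ?_
      have : 0 ≤ Real.exp (b * (ρ + √q) ^ 2) * Real.exp (-b * R ^ 2) := by positivity
      linarith

/-! ### The least squares estimator -/

lemma abs_integral_mul_le_sqrt {T : ℝ} (hT : 0 ≤ T) {f g : ℝ → ℝ}
    (hf : ContinuousOn f (Icc 0 T)) (hg : ContinuousOn g (Icc 0 T)) :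
    |∫ t in (0 : ℝ)..T, f t * g t| ≤
      √(∫ t in (0 : ℝ)..T, f t ^ 2) * √(∫ t in (0 : ℝ)..T, g t ^ 2) := by
  rw [← Real.sqrt_mul (intervalIntegral.integral_nonneg hT fun t _ => sq_nonneg _)]
  refine Real.abs_le_sqrt ?_
  have hff : IntervalIntegrable (fun t => f t ^ 2) volume 0 T :=
    (hf.pow 2).intervalIntegrable_of_Icc hT
  have hfg : IntervalIntegrable (fun t => f t * g t) volume 0 T :=
    (hf.mul hg).intervalIntegrable_of_Icc hT
  have hgg : IntervalIntegrable (fun t => g t ^ 2) volume 0 T :=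
    (hg.pow 2).intervalIntegrable_of_Icc hT
  have hquad : ∀ x : ℝ, 0 ≤ (∫ t in (0 : ℝ)..T, f t ^ 2) * (x * x) +
      (2 * ∫ t in (0 : ℝ)..T, f t * g t) * x + ∫ t in (0 : ℝ)..T, g t ^ 2 := by
    intro x
    have h0 : 0 ≤ ∫ t in (0 : ℝ)..T, (x * f t + g t) ^ 2 :=
      intervalIntegral.integral_nonneg hT fun t _ => sq_nonneg _
    have h1 : ∫ t in (0 : ℝ)..T, (x * f t + g t) ^ 2 =
        ∫ t in (0 : ℝ)..T, (x * x * f t ^ 2 + 2 * x * (f t * g t)) + g t ^ 2 :=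
      intervalIntegral.integral_congr fun t _ => by ring
    rw [h1, intervalIntegral.integral_add ((hff.const_mul _).add (hfg.const_mul _)) hgg,
      intervalIntegral.integral_add (hff.const_mul _) (hfg.const_mul _),
      intervalIntegral.integral_const_mul, intervalIntegral.integral_const_mul] at h0
    linarith
  have := discrim_le_zero hquad
  rw [discrim] at this
  linarith

section Regression

variable {q : ℕ} {a : ℝ → EuclideanSpace ℝ (Fin q) → ℝ} {Θ : Set (EuclideanSpace ℝ (Fin q))}
  {θ : EuclideanSpace ℝ (Fin q)} {s : Fin q → ℝ} {T : ℝ}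

lemma diagMul_inv_diagMul (hs : ∀ i, s i ≠ 0) (u : EuclideanSpace ℝ (Fin q)) :
    diagMul (fun i => (s i)⁻¹) (diagMul s u) = u := by
  ext i
  simp [diagMul, hs i]

lemma regIncrement_diagMul (hs : ∀ i, s i ≠ 0) (t : ℝ) (τ : EuclideanSpace ℝ (Fin q)) :
    regIncrement a θ s t (diagMul s (τ - θ)) = a t τ - a t θ := by
  simp [regIncrement, diagMul_inv_diagMul hs]

lemma zero_mem_normalizedSet (hθ : θ ∈ Θ) : (0 : EuclideanSpace ℝ (Fin q)) ∈
    normalizedSet Θ θ s :=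
  ⟨θ, subset_closure hθ, by ext i; simp [diagMul]⟩

lemma regIncrement_zero (t : ℝ) : regIncrement a θ s t 0 = 0 := by
  have : diagMul (fun i => (s i)⁻¹) (0 : EuclideanSpace ℝ (Fin q)) = 0 := by
    ext i
    simp [diagMul]
  simp [regIncrement, this]

lemma continuousOn_section (ha : ContinuousOn (fun p : ℝ × EuclideanSpace ℝ (Fin q) => a p.1 p.2)
      (Ici (0 : ℝ) ×ˢ closure Θ)) {τ : EuclideanSpace ℝ (Fin q)} (hτ : τ ∈ closure Θ) :
    ContinuousOn (fun t => a t τ) (Icc 0 T) :=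
  ha.comp (continuousOn_id.prodMk continuousOn_const) fun _ ht => ⟨ht.1, hτ⟩

lemma continuousOn_regIncrement
    (ha : ContinuousOn (fun p : ℝ × EuclideanSpace ℝ (Fin q) => a p.1 p.2)
      (Ici (0 : ℝ) ×ˢ closure Θ)) (hs : ∀ i, s i ≠ 0) (hθ : θ ∈ Θ)
    {u : EuclideanSpace ℝ (Fin q)} (hu : u ∈ normalizedSet Θ θ s) :
    ContinuousOn (fun t => regIncrement a θ s t u) (Icc 0 T) := by
  obtain ⟨τ, hτ, rfl⟩ := hu
  simp only [regIncrement_diagMul hs]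
  exact (continuousOn_section ha hτ).sub (continuousOn_section ha (subset_closure hθ))

/-- The basic inequality for the least squares estimator: the drift at the normalized error is
dominated by twice the noise term. -/
lemma half_regDist_le_of_lsFunctional_eq
    (ha : ContinuousOn (fun p : ℝ × EuclideanSpace ℝ (Fin q) => a p.1 p.2)
      (Ici (0 : ℝ) ×ˢ closure Θ)) (hs : ∀ i, s i ≠ 0) (hθ : θ ∈ Θ) (hT : 0 ≤ T)
    {x : ℝ → ℝ} (hx : Continuous x) {τ : EuclideanSpace ℝ (Fin q)} (hτ : τ ∈ closure Θ)
    (hmin : lsFunctional a (fun t => a t θ + x t) T τ =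
      ⨅ τ' : closure Θ, lsFunctional a (fun t => a t θ + x t) T τ') :
    1 / 2 * regDist a θ s T (diagMul s (τ - θ)) 0 ≤
      ∫ t in (0 : ℝ)..T, x t * regIncrement a θ s t (diagMul s (τ - θ)) := by
  have hnn : ∀ τ', 0 ≤ lsFunctional a (fun t => a t θ + x t) T τ' := fun τ' =>
    intervalIntegral.integral_nonneg hT fun t _ => sq_nonneg _
  -- The true parameter competes in the infimum; `ciInf_le` needs the lower bound 0.
  have hle : lsFunctional a (fun t => a t θ + x t) T τ ≤
      lsFunctional a (fun t => a t θ + x t) T θ := by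
    rw [hmin]
    exact ciInf_le (f := fun τ' : closure Θ => lsFunctional a (fun t => a t θ + x t) T τ')
      ⟨0, by rintro _ ⟨τ', rfl⟩; exact hnn τ'⟩ ⟨θ, subset_closure hθ⟩
  set D : ℝ → ℝ := fun t => a t τ - a t θ with hD
  have hDc : ContinuousOn D (Icc 0 T) :=
    (continuousOn_section ha hτ).sub (continuousOn_section ha (subset_closure hθ))
  have hxc : ContinuousOn x (Icc 0 T) := hx.continuousOn
  have hxx : IntervalIntegrable (fun t => x t ^ 2) volume 0 T :=
    (hxc.pow 2).intervalIntegrable_of_Icc hT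
  have hxD : IntervalIntegrable (fun t => x t * D t) volume 0 T :=
    (hxc.mul hDc).intervalIntegrable_of_Icc hT
  have hDD : IntervalIntegrable (fun t => D t ^ 2) volume 0 T :=
    (hDc.pow 2).intervalIntegrable_of_Icc hT
  have h1 : lsFunctional a (fun t => a t θ + x t) T τ =
      (∫ t in (0 : ℝ)..T, x t ^ 2) - 2 * (∫ t in (0 : ℝ)..T, x t * D t) +
        ∫ t in (0 : ℝ)..T, D t ^ 2 := by
    rw [← intervalIntegral.integral_const_mul, ← intervalIntegral.integral_sub hxx
      (hxD.const_mul 2), ← intervalIntegral.integral_add (hxx.sub (hxD.const_mul 2)) hDD]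
    exact intervalIntegral.integral_congr fun t _ => by simp only [hD]; ring
  have h2 : lsFunctional a (fun t => a t θ + x t) T θ = ∫ t in (0 : ℝ)..T, x t ^ 2 := by
    simp [lsFunctional]
  simp only [regDist, regIncrement_diagMul hs, regIncrement_zero, sub_zero]
  rw [h1, h2] at hle
  simp only [hD] at hle
  linarith

/-- Pointwise, the difference of the two sides is the perfect square (v/4 − 4(v − u))², u and v
standing for the increments. -/
lemma regDist_comparison
    (ha : ContinuousOn (fun p : ℝ × EuclideanSpace ℝ (Fin q) => a p.1 p.2)
      (Ici (0 : ℝ) ×ˢ closure Θ)) (hs : ∀ i, s i ≠ 0) (hθ : θ ∈ Θ) (hT : 0 ≤ T)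
    {u v : EuclideanSpace ℝ (Fin q)} (hu : u ∈ normalizedSet Θ θ s)
    (hv : v ∈ normalizedSet Θ θ s) :
    15 / 16 * regDist a θ s T v 0 ≤ regDist a θ s T u 0 + 15 * regDist a θ s T u v := by
  have hcu := continuousOn_regIncrement (T := T) ha hs hθ hu
  have hcv := continuousOn_regIncrement (T := T) ha hs hθ hv
  have huu : IntervalIntegrable (fun t => regIncrement a θ s t u ^ 2) volume 0 T :=
    (hcu.pow 2).intervalIntegrable_of_Icc hT
  have hvv : IntervalIntegrable (fun t => regIncrement a θ s t v ^ 2) volume 0 T :=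
    (hcv.pow 2).intervalIntegrable_of_Icc hT
  have huv : IntervalIntegrable
      (fun t => (regIncrement a θ s t u - regIncrement a θ s t v) ^ 2) volume 0 T :=
    ((hcu.sub hcv).pow 2).intervalIntegrable_of_Icc hT
  simp only [regDist, regIncrement_zero, sub_zero]
  rw [← intervalIntegral.integral_const_mul, ← intervalIntegral.integral_const_mul,
    ← intervalIntegral.integral_add huu (huv.const_mul 15)]
  refine intervalIntegral.integral_mono_on hT (hvv.const_mul _)
    (huu.add (huv.const_mul 15)) fun t _ => ?_
  nlinarith [sq_nonneg (regIncrement a θ s t v / 4 -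
    4 * (regIncrement a θ s t v - regIncrement a θ s t u))]

end Regression

end

/-! ### Exponential bound for the normalized error -/

theorem theorem2 {Ω : Type*} [MeasurableSpace Ω] (P : Measure Ω) [IsProbabilityMeasure P]
    (ε : ℝ → Ω → ℝ) (d₀ : ℝ) (hd₀ : 0 < d₀)
    (hN1 : IsContinuousCentredNoise P ε) (hN2 : IsSubGaussianNoise P ε d₀)
    (q : ℕ) (Θ : Set (EuclideanSpace ℝ (Fin q)))
    (hΘ_open : IsOpen Θ) (hΘ_bounded : Bornology.IsBounded Θ) (hΘ_convex : Convex ℝ Θ)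
    (a : ℝ → EuclideanSpace ℝ (Fin q) → ℝ)
    (ha : ContinuousOn (fun p : ℝ × EuclideanSpace ℝ (Fin q) => a p.1 p.2)
      (Ici (0 : ℝ) ×ˢ closure Θ))
    (s : ℝ → Fin q → ℝ) (c₀ c₁ T₀ : ℝ) (hT₀ : 0 ≤ T₀)
    (hs : ∀ T : ℝ, T₀ < T → ∀ i, s T i ≠ 0)
    (hc₀ : 0 < c₀) (hc₁ : c₀ < c₁) :
    ∃ R₀ : ℝ, ∀ β : ℝ, 0 < β → ∃ B b : ℝ, 0 < B ∧ 0 < b ∧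
      b ≥ c₀ / (8 * d₀ * (1 + q)) - β ∧
      ∀ θ ∈ Θ, QuadraticCondition a Θ θ s c₀ c₁ T₀ →
        ∀ T : ℝ, T₀ < T → ∀ θT : Ω → EuclideanSpace ℝ (Fin q), IsLSE P ε a Θ θ T θT →
          ∀ R : ℝ, R₀ < R →
            P.real {ω | R ≤ ‖diagMul (s T) (θT ω - θ)‖} ≤ B * Real.exp (-b * R ^ 2) := by
  have hc₁' : 0 < c₁ := hc₀.trans hc₁
  -- R₀ = 0 suffices, and b is taken equal to c₀/(8d₀(1+q)) for every β.
  refine ⟨0, fun β hβ => ?_⟩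
  -- For q = 0 the error vanishes, so the event is empty as R > 0; chaining needs a positive
  -- diameter √q.
  rcases Nat.eq_zero_or_pos q with rfl | hq
  · refine ⟨1, c₀ / (8 * d₀ * (1 + (0 : ℕ))), one_pos, by positivity, by linarith, ?_⟩
    intro θ _ _ T _ θT _ R hR
    have : {ω | R ≤ ‖diagMul (s T) (θT ω - θ)‖} = ∅ := by
      ext ω
      simp only [mem_ofPred_eq, mem_empty_iff_false, iff_false, not_le]
      rwa [Subsingleton.elim (diagMul (s T) (θT ω - θ)) 0, norm_zero]
    rw [this, measureReal_empty]
    positivity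
  obtain ⟨B, hB, hmain⟩ := exists_measure_half_drift_le P hq hc₀ hc₁' hd₀
  refine ⟨B, c₀ / (8 * d₀ * (1 + q)), hB, by positivity, by linarith, ?_⟩
  intro θ hθ hR3 T hT θT hLSE R hR
  have hT0 : 0 < T := hT₀.trans_lt hT
  have hsT := hs T hT
  set U := normalizedSet Θ θ (s T) with hU
  set g : EuclideanSpace ℝ (Fin q) → ℝ → ℝ := fun u t => regIncrement a θ (s T) t u with hg
  have hgc : ∀ u ∈ U, ContinuousOn (g u) (Icc 0 T) := fun u hu =>
    continuousOn_regIncrement ha hsT hθ hu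
  have h0U : (0 : EuclideanSpace ℝ (Fin q)) ∈ U := zero_mem_normalizedSet hθ
  set η : EuclideanSpace ℝ (Fin q) → Ω → ℝ := fun u ω => ∫ t in (0 : ℝ)..T, ε t ω * g u t
    with hη
  have hsub : ∀ᵐ ω ∂P, ∀ u ∈ U, ∀ v ∈ U,
      η u ω - η v ω = ∫ t in (0 : ℝ)..T, ε t ω * (g u t - g v t) := by
    filter_upwards [hN1.ae_continuous] with ω hω u hu v hv
    have hint : ∀ w ∈ U, IntervalIntegrable (fun t => ε t ω * g w t) volume 0 T := fun w hw =>
      (hω.continuousOn.mul (hgc w hw)).intervalIntegrable_of_Icc hT0.le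
    simp only [hη]
    rw [← intervalIntegral.integral_sub (hint u hu) (hint v hv)]
    exact intervalIntegral.integral_congr fun t _ => by ring
  have hpt : ∀ v ∈ U, 0 < regDist a θ (s T) T v 0 → ∀ x ≥ 0, P {ω | x ≤ η v ω} ≤
      ENNReal.ofReal (Real.exp (-(x ^ 2 / (2 * (d₀ * regDist a θ (s T) T v 0))))) := by
    intro v hv hpos x hx
    refine measure_integral_noise_ge_le hN1 hN2 hT0 (hgc v hv) (by positivity) ?_ hx
    simp [regDist, regIncrement_zero, hg]
  have htail : ∀ u ∈ U, ∀ v ∈ U, ∀ ℓ > 0, ‖u - v‖ ≤ ℓ → ∀ x ≥ 0,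
      P {ω | x ≤ η u ω - η v ω} ≤
        ENNReal.ofReal (Real.exp (-(x ^ 2 / (2 * (d₀ * c₁ * ℓ ^ 2))))) := by
    intro u hu v hv ℓ hℓ huv x hx
    refine (measure_mono_ae ?_).trans (measure_integral_noise_ge_le hN1 hN2 hT0
      ((hgc u hu).sub (hgc v hv)) (by positivity) ?_ hx)
    · filter_upwards [hsub] with ω hω hxω
      change x ≤ η u ω - η v ω at hxω
      rw [hω u hu v hv] at hxω
      exact hxω
    · have h1 := (hR3 T hT u hu v hv).2
      have h2 : c₁ * ‖u - v‖ ^ 2 ≤ c₁ * ℓ ^ 2 := by gcongr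
      rw [mul_assoc]
      exact mul_le_mul_of_nonneg_left (h1.trans h2) hd₀.le
  have hlip : ∀ᵐ ω ∂P, ∃ K, ∀ u ∈ U, ∀ v ∈ U, |η u ω - η v ω| ≤ K * ‖u - v‖ := by
    filter_upwards [hN1.ae_continuous, hsub] with ω hω hsubω
    -- Cauchy–Schwarz in L₂([0, T]), then the upper half of the quadratic condition.
    refine ⟨√(∫ t in (0 : ℝ)..T, ε t ω ^ 2) * √c₁, fun u hu v hv => ?_⟩
    rw [hsubω u hu v hv, mul_assoc]
    refine (abs_integral_mul_le_sqrt hT0.le hω.continuousOn ((hgc u hu).sub (hgc v hv))).trans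
      (mul_le_mul_of_nonneg_left ?_ (Real.sqrt_nonneg _))
    rw [← Real.sqrt_sq (norm_nonneg (u - v)), ← Real.sqrt_mul hc₁'.le]
    exact Real.sqrt_le_sqrt (hR3 T hT u hu v hv).2
  have hbound := hmain U η (fun u => regDist a θ (s T) T u 0)
    (fun u hu => by simpa using (hR3 T hT u hu 0 h0U).1)
    (fun u hu v hv => (regDist_comparison ha hsT hθ hT0.le hu hv).trans
      (by linarith [(hR3 T hT u hu v hv).2]))
    hpt htail hlip R hR.le
  refine ENNReal.toReal_le_of_le_ofReal (by positivity) (le_trans (measure_mono_ae ?_) hbound)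
  filter_upwards [hN1.ae_continuous, hLSE.mem_closure, hLSE.minimizes] with ω hω hmem hmin hRω
  exact ⟨_, ⟨θT ω, hmem, rfl⟩, hRω,
    half_regDist_le_of_lsFunctional_eq ha hsT hθ hT0.le hω hmem hmin⟩
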